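/- Let $q\ge 4$ be a prime power, let $n=q^2-1$, and let $\mathbb F_q$ be the finite field with $q$ elements. Then there exists a convolutional code over $\mathbb F_q$ with parameters $(n,\,n-2q,\,2q-4;\,1,\,d_{free})_q$ and $d_{free}\ge 2q+1$. Here a convolutional code with parameters $(n,k,\gamma;\mu,d_{free})_q$ is a submodule $C=\{\mathbf u(D)G(D) : \mathbf u(D)\in\mathbb F_q[D]^k\}$ of $\mathbb F_q[D]^n$, where $G(D)=(g_{ij})\in\mathbb F_q[D]^{k\times n}$ is a reduced basic matrix. Basic means that $G(D)$ has a polynomial right inverse. With $\gamma_i=\max_{1\le j\le n}\deg g_{ij}$, reduced means that $\sum_{i=1}^k\gamma_i$ is smallest among all basic generator matrices of the same code $C$. The degree is $\gamma=\sum_{i=1}^k\gamma_i$, the memory is $\mu=\max_{1\le i\le k}\gamma_i$, and the free distance $d_{free}$ is the minimum of $\mathrm{wt}(\mathbf v(D))$ over all nonzero $\mathbf v(D)\in C$, where $\mathrm{wt}(\mathbf v(D))$ is the total number of nonzero coefficients of the $n$ polynomials that are the entries of $\mathbf v(D)$. -/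

import Mathlib

open Polynomial

namespace ConvCode

variable {F : Type*} [Field F] {k n : ℕ}

/-- A polynomial encoder matrix `G(D)` is basic if it has a polynomial right inverse. -/
def IsBasic (G : Matrix (Fin k) (Fin n) F[X]) : Prop :=
  ∃ R : Matrix (Fin n) (Fin k) F[X], G * R = 1

/-- The submodule `{u(D) G(D)}` of `F[D]^n` generated by the rows of `G(D)`. -/
noncomputable def codeOf (G : Matrix (Fin k) (Fin n) F[X]) :
    Submodule F[X] (Fin n → F[X]) :=
  LinearMap.range G.vecMulLinear

/-- The `i`-th constraint length: the maximal degree of an entry of the `i`-th row. -/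
noncomputable def constraintLength (G : Matrix (Fin k) (Fin n) F[X]) (i : Fin k) : ℕ :=
  Finset.univ.sup fun j => (G i j).natDegree

/-- The overall constraint length: the sum of the constraint lengths. -/
noncomputable def overallConstraintLength (G : Matrix (Fin k) (Fin n) F[X]) : ℕ :=
  ∑ i, constraintLength G i

/-- The memory: the maximum of the constraint lengths. -/
noncomputable def memory (G : Matrix (Fin k) (Fin n) F[X]) : ℕ :=
  Finset.univ.sup fun i => constraintLength G i

/-- A basic generator matrix is reduced if its overall constraint length is the smallest
among all basic generator matrices of the same code. -/
def IsReducedBasic (G : Matrix (Fin k) (Fin n) F[X]) : Prop :=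
  IsBasic G ∧ ∀ G' : Matrix (Fin k) (Fin n) F[X], IsBasic G' → codeOf G' = codeOf G →
    overallConstraintLength G ≤ overallConstraintLength G'

/-- The Hamming weight of `v(D)`: the total number of nonzero coefficients of its entries. -/
def weight (v : Fin n → F[X]) : ℕ :=
  ∑ j, (v j).support.card

/-- `d` is the free distance of `C`: the least weight of a nonzero element of `C`. -/
def IsFreeDistance (C : Submodule F[X] (Fin n → F[X])) (d : ℕ) : Prop :=
  IsLeast {w : ℕ | ∃ v ∈ C, v ≠ 0 ∧ weight v = w} d

/-- `C` is a convolutional code with parameters `(n, k, γ; μ, d)` over `F`. -/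
def IsConvolutionalCode (C : Submodule F[X] (Fin n → F[X])) (k γ μ d : ℕ) : Prop :=
  (∃ G : Matrix (Fin k) (Fin n) F[X], IsReducedBasic G ∧ C = codeOf G ∧
    overallConstraintLength G = γ ∧ memory G = μ) ∧
  IsFreeDistance C d

end ConvCode

/-! ### Encoders of the form `A + B X`. -/

namespace ConvCode

variable {F : Type*} [Field F] {k n : ℕ}

/-! Take the BCH code over F of length q² - 1 whose zeros are the powers 0, …, 2q - 1, and split its
parity check into H₀ (exponents 0, …, q + 1) and H₁ (exponents q + 2, …, 2q - 1). The convolutional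
code is annihilated by H₀ + ι H₁ X, with ι an injection of syndrome spaces.

Distance (`IsParityCheck.le_weight`): the first nonzero coefficient vector of a codeword lies in ker
H₀, the last in ker H₁. If they sit at different times the two BCH bounds add up; if they coincide,
the bound for the whole BCH code applies.

Parameters: once (H₀, H₁) is onto, a section of it gives an explicit encoder `A + B X` with a
constant right inverse, having dim ker (H₀, H₁) constant rows and `m₁` rows of degree 1. No basic
encoder of the code has more constant rows, since these are independent words of ker (H₀, H₁); so
the encoder is reduced.

Surjectivity (`surjective_lowCheck_prod_highCheck`) holds because the chosen exponents lie in
distinct cyclotomic cosets modulo q² - 1, of size 1 for 0 and q + 1 and size 2 otherwise. The ranks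
are thus 2q and 2q - 4. -/

/-- The vector of coefficients of `X ^ t` of a polynomial vector. -/
def coeffVec (t : ℕ) (v : Fin n → F[X]) : Fin n → F := fun j => (v j).coeff t

theorem coeffVec_ne_zero_of_ne_zero {v : Fin n → F[X]} (hv : v ≠ 0) : ∃ t, coeffVec t v ≠ 0 := by
  by_contra! h
  refine hv (funext fun j => Polynomial.ext fun t => ?_)
  exact congrFun (h t) j

theorem exists_coeffVec_eq_zero (v : Fin n → F[X]) : ∃ N, ∀ t, N ≤ t → coeffVec t v = 0 := by
  refine ⟨(Finset.univ.sup fun j => (v j).natDegree) + 1, fun t ht => funext fun j => ?_⟩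
  apply coeff_eq_zero_of_natDegree_lt
  have := Finset.le_sup (f := fun j => (v j).natDegree) (Finset.mem_univ j)
  exact lt_of_le_of_lt this ht

theorem sum_hammingNorm_coeffVec_le_weight [DecidableEq F] (v : Fin n → F[X]) (T : Finset ℕ) :
    ∑ t ∈ T, hammingNorm (coeffVec t v) ≤ weight v := by
  have h1 : ∀ t, hammingNorm (coeffVec t v) = ∑ j, if (v j).coeff t ≠ 0 then 1 else 0 := by
    exact fun t => Finset.card_filter _ _
  simp only [h1]
  rw [Finset.sum_comm]
  refine Finset.sum_le_sum fun j _ => ?_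
  rw [← Finset.card_filter]
  refine Finset.card_le_card fun t ht => ?_
  simpa using (Finset.mem_filter.1 ht).2

/-- The polynomial matrix `A + B X`. -/
noncomputable def linearEncoder (A B : Matrix (Fin k) (Fin n) F) : Matrix (Fin k) (Fin n) F[X] :=
  Matrix.of fun i j => C (A i j) + X * C (B i j)

theorem linearEncoder_eq (A B : Matrix (Fin k) (Fin n) F) :
    linearEncoder A B = A.map C + (X : F[X]) • B.map C := by
  ext1 i j
  simp [linearEncoder]

theorem isBasic_linearEncoder {A B : Matrix (Fin k) (Fin n) F} {R : Matrix (Fin n) (Fin k) F}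
    (hA : A * R = 1) (hB : B * R = 0) : IsBasic (linearEncoder A B) := by
  refine ⟨R.map C, ?_⟩
  rw [linearEncoder_eq, Matrix.add_mul, Matrix.smul_mul, ← Matrix.map_mul, ← Matrix.map_mul, hA, hB]
  simp [Matrix.map_zero]

theorem constraintLength_linearEncoder_of_eq_zero {A B : Matrix (Fin k) (Fin n) F} {i : Fin k}
    (h : B i = 0) : constraintLength (linearEncoder A B) i = 0 := by
  simp [constraintLength, linearEncoder, h]

theorem constraintLength_linearEncoder_of_ne_zero {A B : Matrix (Fin k) (Fin n) F} {i : Fin k}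
    (h : B i ≠ 0) : constraintLength (linearEncoder A B) i = 1 := by
  apply le_antisymm
  · refine Finset.sup_le fun j _ => ?_
    refine (natDegree_add_le _ _).trans (max_le (by simp) ?_)
    exact (natDegree_mul_C_le X _).trans natDegree_X_le
  · obtain ⟨j, hj⟩ := Function.ne_iff.1 h
    refine le_trans ?_ (Finset.le_sup (Finset.mem_univ j))
    apply le_natDegree_of_ne_zero
    simpa [linearEncoder, coeff_C] using hj

theorem coeffVec_zero_vecMul_linearEncoder (A B : Matrix (Fin k) (Fin n) F) (u : Fin k → F[X]) :
    coeffVec 0 (Matrix.vecMul u (linearEncoder A B)) = Matrix.vecMul (coeffVec 0 u) A := by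
  ext j
  simp [coeffVec, Matrix.vecMul, dotProduct, linearEncoder, mul_coeff_zero]

theorem coeffVec_succ_vecMul_linearEncoder (A B : Matrix (Fin k) (Fin n) F) (u : Fin k → F[X])
    (t : ℕ) : coeffVec (t + 1) (Matrix.vecMul u (linearEncoder A B)) =
      Matrix.vecMul (coeffVec (t + 1) u) A + Matrix.vecMul (coeffVec t u) B := by
  ext j
  simp only [coeffVec, Matrix.vecMul, dotProduct, linearEncoder, Matrix.of_apply, finsetSum_coeff,
    Pi.add_apply, ← Finset.sum_add_distrib]
  refine Finset.sum_congr rfl fun i _ => ?_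
  rw [mul_add, coeff_add, coeff_mul_C, ← mul_assoc, coeff_mul_C, coeff_mul_X]

/-! ### Syndrome formers and the free distance. -/

variable {A₀ A₁ : Type*} [AddCommGroup A₀] [Module F A₀] [AddCommGroup A₁] [Module F A₁]

theorem map_vecMul (H : (Fin n → F) →ₗ[F] A₀) (x : Fin k → F) (M : Matrix (Fin k) (Fin n) F) :
    H (Matrix.vecMul x M) = ∑ i, x i • H (M i) := by
  rw [Matrix.vecMul_eq_sum, map_sum]
  simp

/-- The syndrome former `H₀ + ι H₁ X` annihilates every codeword `v`, coefficientwise. -/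
def IsParityCheck (H₀ : (Fin n → F) →ₗ[F] A₀) (H₁ : (Fin n → F) →ₗ[F] A₁) (ι : A₁ →ₗ[F] A₀)
    (v : Fin n → F[X]) : Prop :=
  H₀ (coeffVec 0 v) = 0 ∧ ∀ t, H₀ (coeffVec (t + 1) v) + ι (H₁ (coeffVec t v)) = 0

/-- The hypotheses say that the coefficients of 1, X and X² vanish when H₀ + ι H₁ X is applied to
the rows of `A + B X`. -/
theorem isParityCheck_of_mem_codeOf_linearEncoder {H₀ : (Fin n → F) →ₗ[F] A₀}
    {H₁ : (Fin n → F) →ₗ[F] A₁} {ι : A₁ →ₗ[F] A₀} {A B : Matrix (Fin k) (Fin n) F}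
    (hA : ∀ i, H₀ (A i) = 0) (hB : ∀ i, H₁ (B i) = 0) (hAB : ∀ i, H₀ (B i) + ι (H₁ (A i)) = 0)
    {v : Fin n → F[X]} (hv : v ∈ codeOf (linearEncoder A B)) : IsParityCheck H₀ H₁ ι v := by
  obtain ⟨u, rfl⟩ := hv
  have hA' : ∀ x, H₀ (Matrix.vecMul x A) = 0 := fun x => by simp [map_vecMul, hA]
  have hB' : ∀ x, H₁ (Matrix.vecMul x B) = 0 := fun x => by simp [map_vecMul, hB]
  have hAB' : ∀ x, H₀ (Matrix.vecMul x B) + ι (H₁ (Matrix.vecMul x A)) = 0 := fun x => by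
    simp only [map_vecMul, map_sum, map_smul, ← Finset.sum_add_distrib, ← smul_add, hAB, smul_zero,
      Finset.sum_const_zero]
  simp only [Matrix.vecMulLinear_apply]
  refine ⟨by rw [coeffVec_zero_vecMul_linearEncoder, hA'], fun t => ?_⟩
  rw [coeffVec_succ_vecMul_linearEncoder, map_add, hA', zero_add]
  have : H₁ (coeffVec t (Matrix.vecMul u (linearEncoder A B))) =
      H₁ (Matrix.vecMul (coeffVec t u) A) := by
    cases t with
    | zero => rw [coeffVec_zero_vecMul_linearEncoder]
    | succ t => rw [coeffVec_succ_vecMul_linearEncoder, map_add, hB', add_zero]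
  rw [this, hAB']

/-- At the first nonzero time `s` the H₁ term of the check is absent, and one step after the last
nonzero time `e` the H₀ term is absent. -/
theorem IsParityCheck.le_weight [DecidableEq F] {H₀ : (Fin n → F) →ₗ[F] A₀}
    {H₁ : (Fin n → F) →ₗ[F] A₁}
    {ι : A₁ →ₗ[F] A₀} (hι : Function.Injective ι) {v : Fin n → F[X]}
    (h : IsParityCheck H₀ H₁ ι v) (hv : v ≠ 0) {d₀ d₁ : ℕ}
    (h₀ : ∀ w, w ≠ 0 → H₀ w = 0 → d₀ ≤ hammingNorm w)
    (h₁ : ∀ w, w ≠ 0 → H₁ w = 0 → d₁ ≤ hammingNorm w)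
    (h₀₁ : ∀ w, w ≠ 0 → H₀ w = 0 → H₁ w = 0 → d₀ + d₁ ≤ hammingNorm w) :
    d₀ + d₁ ≤ weight v := by
  classical
  have hex := coeffVec_ne_zero_of_ne_zero hv
  obtain ⟨N, hN⟩ := exists_coeffVec_eq_zero v
  have hs := Nat.find_spec hex
  have hs' : ∀ t < Nat.find hex, coeffVec t v = 0 := fun t ht => not_not.1 (Nat.find_min hex ht)
  set s := Nat.find hex
  have hsN : s ≤ N := by
    by_contra! hc
    exact hs (hN s hc.le)
  have he := Nat.findGreatest_spec (P := fun t => coeffVec t v ≠ 0) hsN hs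
  have he' : ∀ t, Nat.findGreatest (fun t => coeffVec t v ≠ 0) N < t → coeffVec t v = 0 := by
    intro t ht
    by_cases htN : t ≤ N
    · exact not_not.1 (Nat.findGreatest_is_greatest ht htN)
    · exact hN t (by omega)
  set e := Nat.findGreatest (fun t => coeffVec t v ≠ 0) N
  have hs₀ : H₀ (coeffVec s v) = 0 := by
    rcases Nat.eq_zero_or_pos s with h0 | h0
    · rw [h0, h.1]
    · have := h.2 (s - 1)
      rwa [hs' (s - 1) (by omega), map_zero, map_zero, add_zero, Nat.sub_add_cancel h0] at this
  have he₁ : H₁ (coeffVec e v) = 0 := by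
    have := h.2 e
    rw [he' (e + 1) (by omega), map_zero, zero_add] at this
    exact hι (by rw [this, map_zero])
  by_cases hse : s = e
  · refine (h₀₁ _ hs hs₀ (hse ▸ he₁)).trans ?_
    simpa using sum_hammingNorm_coeffVec_le_weight v {s}
  · refine (Nat.add_le_add (h₀ _ hs hs₀) (h₁ _ he he₁)).trans ?_
    simpa [Finset.sum_pair hse] using sum_hammingNorm_coeffVec_le_weight v {s, e}

/-! ### Lower bound for the degree of a basic encoder. -/

theorem IsBasic.vecMul_injective {G : Matrix (Fin k) (Fin n) F[X]} (hG : IsBasic G)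
    {u : Fin k → F[X]} (hu : Matrix.vecMul u G = 0) : u = 0 := by
  obtain ⟨R, hR⟩ := hG
  have := congrArg (fun w => Matrix.vecMul w R) hu
  simpa [Matrix.vecMul_vecMul, hR] using this

theorem row_mem_codeOf (G : Matrix (Fin k) (Fin n) F[X]) (i : Fin k) : G i ∈ codeOf G :=
  ⟨Pi.single i 1, by simp; rfl⟩

theorem row_eq_C_coeffVec {G : Matrix (Fin k) (Fin n) F[X]} {i : Fin k}
    (hi : constraintLength G i = 0) (j : Fin n) : G i j = C (coeffVec 0 (G i) j) := by
  apply eq_C_of_natDegree_eq_zero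
  have := Finset.le_sup (f := fun j => (G i j).natDegree) (Finset.mem_univ j)
  exact Nat.le_zero.1 (this.trans hi.le)

/-- The constant rows of a basic encoder of a code with parity check `H₀ + ι H₁ X` are linearly
independent words of the block code with parity check `(H₀, H₁)`. -/
theorem IsBasic.le_overallConstraintLength_add_finrank_ker {H₀ : (Fin n → F) →ₗ[F] A₀}
    {H₁ : (Fin n → F) →ₗ[F] A₁}
    {ι : A₁ →ₗ[F] A₀} (hι : Function.Injective ι) {G : Matrix (Fin k) (Fin n) F[X]}
    (hG : IsBasic G) (hc : ∀ v ∈ codeOf G, IsParityCheck H₀ H₁ ι v) :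
    k ≤ overallConstraintLength G + Module.finrank F (LinearMap.ker (H₀.prod H₁)) := by
  classical
  set Z : Finset (Fin k) := {i | constraintLength G i = 0} with hZ
  have hZmem : ∀ i : Z, constraintLength G i = 0 := fun i => (Finset.mem_filter.1 i.2).2
  have hker : ∀ i : Z, coeffVec 0 (G i) ∈ LinearMap.ker (H₀.prod H₁) := by
    intro i
    have h := hc _ (row_mem_codeOf G i)
    have h1 : coeffVec 1 (G i) = 0 := by
      funext j
      simp only [coeffVec]
      rw [row_eq_C_coeffVec (hZmem i) j]
      simp
    have h2 := h.2 0
    rw [zero_add, h1, map_zero, zero_add] at h2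
    have h3 : H₁ (coeffVec 0 (G i)) = 0 := hι (by rw [h2, map_zero])
    simp [h.1, h3]
  let z : Z → LinearMap.ker (H₀.prod H₁) := fun i => ⟨coeffVec 0 (G i), hker i⟩
  have hli : LinearIndependent F z := by
    rw [Fintype.linearIndependent_iff]
    intro a ha i
    -- A relation among the constant rows, extended by zero, is a relation among all rows of `G`,
    -- which the right inverse forbids.
    let u : Fin k → F[X] := fun i => if h : i ∈ Z then C (a ⟨i, h⟩) else 0
    have hu : Matrix.vecMul u G = 0 := by
      funext j
      have h1 := congrFun (congrArg Subtype.val ha) j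
      simp only [Submodule.coe_sum, Submodule.coe_smul, Finset.sum_apply, Pi.smul_apply,
        smul_eq_mul, Submodule.coe_zero, Pi.zero_apply] at h1
      have h2 : Matrix.vecMul u G j = ∑ i ∈ Z, u i * G i j := by
        simp only [Matrix.vecMul, dotProduct]
        refine (Finset.sum_subset (Finset.subset_univ Z) fun i _ hi => ?_).symm
        simp [u, hi]
      rw [h2, ← Finset.sum_coe_sort]
      have h3 : ∀ i : Z, u i * G i j = C (a i * (z i : Fin n → F) j) := by
        intro i
        rw [row_eq_C_coeffVec (hZmem i) j]
        simp [u, z]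
      rw [Finset.sum_congr rfl fun i _ => h3 i, ← map_sum, h1]
      simp
    have := congrFun (hG.vecMul_injective hu) i
    simpa [u] using this
  have hcard := hli.fintype_card_le_finrank
  rw [Fintype.card_coe] at hcard
  have hsum : (Finset.univ \ Z).card ≤ overallConstraintLength G := by
    rw [Finset.card_eq_sum_ones]
    refine (Finset.sum_le_sum fun i hi => ?_).trans
      (Finset.sum_le_sum_of_subset (Finset.sdiff_subset))
    rw [Nat.one_le_iff_ne_zero]
    simpa [hZ] using hi
  have := Finset.card_sdiff_add_card_eq_card (Finset.subset_univ Z)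
  rw [Finset.card_univ, Fintype.card_fin] at this
  omega

theorem exists_isFreeDistance {C : Submodule F[X] (Fin n → F[X])} (hC : ∃ v ∈ C, v ≠ 0) {d : ℕ}
    (hd : ∀ v ∈ C, v ≠ 0 → d ≤ weight v) : ∃ d', d ≤ d' ∧ IsFreeDistance C d' := by
  have hne : {w : ℕ | ∃ v ∈ C, v ≠ 0 ∧ weight v = w}.Nonempty :=
    let ⟨v, hv, h0⟩ := hC
    ⟨_, v, hv, h0, rfl⟩
  have hmem := Nat.sInf_mem hne
  obtain ⟨v, hv, h0, hw⟩ := id hmem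
  exact ⟨_, (hd v hv h0).trans hw.le, hmem, fun w hw => Nat.sInf_le hw⟩

/-! ### Construction of the code from a block parity check. -/

/-- A surjective block parity check `(H₀, H₁)`, together with an embedding `ι` of the space of
`H₁`-syndromes into that of `H₀`-syndromes, yields a convolutional code of memory `1`. -/
theorem exists_isConvolutionalCode_of_surjective [DecidableEq F]
    [FiniteDimensional F A₀] [FiniteDimensional F A₁] {H₀ : (Fin n → F) →ₗ[F] A₀}
    {H₁ : (Fin n → F) →ₗ[F] A₁} (hH : Function.Surjective (H₀.prod H₁))
    {ι : A₁ →ₗ[F] A₀} (hι : Function.Injective ι) {m₀ m₁ : ℕ}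
    (hm₀ : Module.finrank F A₀ = m₀) (hm₁ : Module.finrank F A₁ = m₁) (hpos : 0 < m₁) {d₀ d₁ : ℕ}
    (h₀ : ∀ w, w ≠ 0 → H₀ w = 0 → d₀ ≤ hammingNorm w)
    (h₁ : ∀ w, w ≠ 0 → H₁ w = 0 → d₁ ≤ hammingNorm w)
    (h₀₁ : ∀ w, w ≠ 0 → H₀ w = 0 → H₁ w = 0 → d₀ + d₁ ≤ hammingNorm w) :
    ∃ (C : Submodule F[X] (Fin n → F[X])) (d : ℕ), d₀ + d₁ ≤ d ∧
      IsConvolutionalCode C (n - m₀) m₁ 1 d := by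
  set H := H₀.prod H₁ with hHdef
  obtain ⟨s, hs⟩ := H.exists_rightInverse_of_surjective (LinearMap.range_eq_top.2 hH)
  have hs' : ∀ x, H (s x) = x := fun x => LinearMap.congr_fun hs x
  have hs₀ : ∀ x, H₀ (s x) = x.1 := fun x => congrArg Prod.fst (hs' x)
  have hs₁ : ∀ x, H₁ (s x) = x.2 := fun x => congrArg Prod.snd (hs' x)
  set r := Module.finrank F (LinearMap.ker H) with hr
  have hrank : m₀ + m₁ + r = n := by
    have := H.finrank_range_add_finrank_ker
    rw [LinearMap.range_eq_top.2 hH, finrank_top, Module.finrank_prod, hm₀, hm₁] at this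
    simpa using this
  set k := n - m₀ with hk
  let bc : Module.Basis (Fin r) F (LinearMap.ker H) := Module.finBasis F _
  let ba : Module.Basis (Fin m₁) F A₁ := Module.finBasisOfFinrankEq F A₁ hm₁
  let e : Fin k ≃ Fin r ⊕ Fin m₁ :=
    (finCongr (by omega : k = r + m₁)).trans finSumFinEquiv.symm
  -- The rows of `A` form a basis of the kernel of H₀. Those with nonzero H₁-syndrome get an X-term
  -- whose H₀-syndrome cancels it through `ι`.
  let A : Matrix (Fin k) (Fin n) F :=
    fun i => Sum.elim (fun l => (bc l : Fin n → F)) (fun l => s (0, ba l)) (e i)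
  let B : Matrix (Fin k) (Fin n) F := fun i => Sum.elim 0 (fun l => s (-ι (ba l), 0)) (e i)
  have hbc : ∀ l, H (bc l) = 0 := fun l => (bc l).2
  have hbc₀ : ∀ l, H₀ (bc l) = 0 := fun l => congrArg Prod.fst (hbc l)
  have hbc₁ : ∀ l, H₁ (bc l) = 0 := fun l => congrArg Prod.snd (hbc l)
  have hA : ∀ i, H₀ (A i) = 0 := by
    intro i
    rcases h : e i with l | l <;> simp [A, h, hbc₀, hs₀]
  have hB : ∀ i, H₁ (B i) = 0 := by
    intro i
    rcases h : e i with l | l <;> simp [B, h, hs₁]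
  have hAB : ∀ i, H₀ (B i) + ι (H₁ (A i)) = 0 := by
    intro i
    rcases h : e i with l | l <;> simp [A, B, h, hs₀, hs₁, hbc₁]
  let π : (Fin n → F) →ₗ[F] LinearMap.ker H :=
    LinearMap.codRestrict _ (LinearMap.id - s ∘ₗ H) fun w => by simp [hs']
  have hπ : ∀ x, π (s x) = 0 := fun x => by ext1; simp [π, hs']
  have hπ' : ∀ l, π (bc l) = bc l := fun l => by ext1; simp [π]
  -- `P` reads off the coordinates of the rows of `A`. It kills `B`, whose rows lie in the image of
  -- `s` and have zero H₁-syndrome.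
  let P : (Fin n → F) →ₗ[F] (Fin k → F) := LinearMap.pi fun i =>
    Sum.elim (fun l => bc.coord l ∘ₗ π) (fun l => ba.coord l ∘ₗ H₁) (e i)
  let R : Matrix (Fin n) (Fin k) F := (LinearMap.toMatrix' P).transpose
  have hR : ∀ (M : Matrix (Fin k) (Fin n) F) i i', (M * R) i i' = P (M i) i' := by
    intro M i i'
    rw [← LinearMap.toMatrix'_mulVec P (M i)]
    simp [Matrix.mul_apply, R, Matrix.mulVec, dotProduct, mul_comm]
  have hAR : A * R = 1 := by
    ext i i'
    have h1 : (1 : Matrix (Fin k) (Fin k) F) i i' = if e i = e i' then 1 else 0 := by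
      simp [Matrix.one_apply]
    rw [hR, h1]
    rcases h : e i with l | l <;> rcases h' : e i' with l' | l' <;>
      simp [A, P, h, h', hπ, hπ', hbc₁, hs₁, Finsupp.single_apply]
  have hBR : B * R = 0 := by
    ext i i'
    rw [hR]
    rcases h : e i with l | l <;> rcases h' : e i' with l' | l' <;>
      simp [B, P, h, h', hπ, hs₁]
  have hlen : ∀ i, constraintLength (linearEncoder A B) i = Sum.elim (fun _ => 0) (fun _ => 1) (e i) := by
    intro i
    rcases h : e i with l | l
    · exact constraintLength_linearEncoder_of_eq_zero (by simp [B, h])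
    · refine constraintLength_linearEncoder_of_ne_zero fun hc => ba.ne_zero l (hι ?_)
      have := hs₀ (-ι (ba l), 0)
      simp only [B, h, Sum.elim_inr] at hc
      simpa [hc] using this
  have hoverall : overallConstraintLength (linearEncoder A B) = m₁ := by
    simp only [overallConstraintLength, hlen]
    rw [e.sum_comp (Sum.elim (fun _ : Fin r => 0) (fun _ : Fin m₁ => 1))]
    simp
  have hmem : memory (linearEncoder A B) = 1 := by
    apply le_antisymm
    · refine Finset.sup_le fun i _ => ?_
      rw [hlen]
      rcases e i with l | l <;> simp
    · refine le_trans ?_ (Finset.le_sup (Finset.mem_univ (e.symm (Sum.inr ⟨0, hpos⟩))))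
      simp [hlen]
  have hbasic := isBasic_linearEncoder hAR hBR
  have hpc : ∀ v ∈ codeOf (linearEncoder A B), IsParityCheck H₀ H₁ ι v :=
    fun v hv => isParityCheck_of_mem_codeOf_linearEncoder hA hB hAB hv
  have hne : ∃ v ∈ codeOf (linearEncoder A B), v ≠ 0 := by
    let i : Fin k := e.symm (Sum.inr ⟨0, hpos⟩)
    refine ⟨_, row_mem_codeOf _ i, fun h => ?_⟩
    have h2 : constraintLength (linearEncoder A B) i = 0 :=
      Nat.le_zero.1 (Finset.sup_le fun j _ => by simp [h])
    simp [hlen, i] at h2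
  obtain ⟨d, hd, hfree⟩ := exists_isFreeDistance hne (d := d₀ + d₁)
    fun v hv h0 => (hpc v hv).le_weight hι h0 h₀ h₁ h₀₁
  refine ⟨_, d, hd, ⟨_, ⟨hbasic, fun G' hG' hcode => ?_⟩, rfl, hoverall, hmem⟩, hfree⟩
  have := hG'.le_overallConstraintLength_add_finrank_ker hι (H₀ := H₀) (H₁ := H₁)
    (by rwa [hcode])
  rw [← hHdef, ← hr] at this
  omega

end ConvCode
-- BCH codes of length q² - 1.
namespace BCHCode

variable {F K : Type*} [Field F] [Field K] [Algebra F K] {n : ℕ}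

/-- The power sum `∑ i, v i * x i ^ j`. -/
noncomputable def syndrome (x : Fin n → K) (j : ℕ) : (Fin n → F) →ₗ[F] K where
  toFun v := ∑ i, algebraMap F K (v i) * x i ^ j
  map_add' v w := by simp [add_mul, Finset.sum_add_distrib]
  map_smul' c v := by simp [Algebra.smul_def, Finset.mul_sum, mul_assoc]

theorem syndrome_apply (x : Fin n → K) (j : ℕ) (v : Fin n → F) :
    syndrome x j v = ∑ i, algebraMap F K (v i) * x i ^ j := rfl

/-- The BCH bound. -/
theorem lt_hammingNorm_of_syndrome_eq_zero [DecidableEq F] {x : Fin n → K}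
    (hx : Function.Injective x) (hx0 : ∀ i, x i ≠ 0) {b d : ℕ} {v : Fin n → F} (hv : v ≠ 0)
    (h : ∀ j < d, syndrome x (b + j) v = 0) : d < hammingNorm v := by
  classical
  by_contra! hd
  obtain ⟨i₀, hi₀⟩ := Function.ne_iff.1 hv
  simp only [Pi.zero_apply] at hi₀
  set S : Finset (Fin n) := {i | v i ≠ 0} with hS
  have hi₀S : i₀ ∈ S := by simpa [hS] using hi₀
  have hSd : S.card ≤ d := hd
  -- Vanishing on the support except at `i₀`, `p` combines the `d` checks into one that sees only `v
  -- i₀`.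
  let p : K[X] := ∏ i ∈ S.erase i₀, (X - C (x i))
  have hdeg : p.natDegree < d := by
    have : p.natDegree = (S.erase i₀).card := natDegree_finsetProd_X_sub_C_eq_card _ _
    rw [this, Finset.card_erase_of_mem hi₀S]
    have := Finset.card_pos.2 ⟨i₀, hi₀S⟩
    omega
  have hsum : ∑ i, algebraMap F K (v i) * x i ^ b * p.eval (x i) = 0 := by
    have : ∀ i, algebraMap F K (v i) * x i ^ b * p.eval (x i) =
        ∑ j ∈ Finset.range d, p.coeff j * (algebraMap F K (v i) * x i ^ (b + j)) := by
      intro i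
      rw [eval_eq_sum_range' hdeg, Finset.mul_sum]
      exact Finset.sum_congr rfl fun j _ => by ring
    simp only [this]
    rw [Finset.sum_comm]
    refine Finset.sum_eq_zero fun j hj => ?_
    rw [← Finset.mul_sum, ← syndrome_apply, h j (Finset.mem_range.1 hj), mul_zero]
  rw [Finset.sum_eq_single i₀] at hsum
  · have hp : p.eval (x i₀) ≠ 0 := by
      rw [eval_prod, Finset.prod_ne_zero_iff]
      intro i hi
      simpa [sub_eq_zero] using hx.ne (Finset.ne_of_mem_erase hi).symm
    have hv0 : algebraMap F K (v i₀) ≠ 0 := by simpa using hi₀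
    exact mul_ne_zero (mul_ne_zero hv0 (pow_ne_zero _ (hx0 _))) hp hsum
  · intro i _ hi
    by_cases hiS : i ∈ S
    · have : p.eval (x i) = 0 := by
        rw [eval_prod]
        exact Finset.prod_eq_zero (Finset.mem_erase.2 ⟨hi, hiS⟩) (by simp)
      rw [this, mul_zero]
    · have : v i = 0 := by simpa [hS] using hiS
      simp [this]
  · simp

theorem exists_trace_eq [FiniteDimensional F K] [Algebra.IsSeparable F K] (φ : K →ₗ[F] F) :
    ∃ c, ∀ y, φ y = Algebra.trace F K (c * y) := by
  refine ⟨((Algebra.traceForm F K).toDual (traceForm_nondegenerate F K)).symm φ, fun y => ?_⟩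
  rw [← Algebra.traceForm_apply, LinearMap.BilinForm.apply_toDual_symm_apply]

variable {q : ℕ}

theorem syndrome_mul_card [Fintype F] (hq : Fintype.card F = q) (x : Fin n → K) (j : ℕ) (v : Fin n → F) :
    syndrome x (j * q) v = syndrome x j v ^ q := by
  obtain ⟨p, _⟩ := CharP.exists F
  have := charP_of_injective_algebraMap (algebraMap F K).injective p
  obtain ⟨m, hp, hm⟩ := FiniteField.card F p
  have : Fact p.Prime := ⟨hp⟩
  rw [syndrome_apply, syndrome_apply, ← hq, hm, sum_pow_char_pow]
  refine Finset.sum_congr rfl fun i _ => ?_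
  rw [mul_pow, ← map_pow, ← hm, FiniteField.pow_card, pow_mul]

theorem algebraMap_norm_eq_pow_add_one [Fintype F] [Finite K]
    (hq : Fintype.card F = q) (hK : Module.finrank F K = 2)
    (y : K) : algebraMap F K (Algebra.norm F y) = y ^ (q + 1) := by
  rw [FiniteField.algebraMap_norm_eq_pow_sum, hK, Nat.card_eq_fintype_card, hq]
  simp [Finset.sum_range_succ, add_comm]

theorem algebraMap_trace_eq_add_pow [Fintype F] [Finite K]
    (hq : Fintype.card F = q) (hK : Module.finrank F K = 2)
    (y : K) : algebraMap F K (Algebra.trace F K y) = y + y ^ q := by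
  rw [FiniteField.algebraMap_trace_eq_sum_pow, hK, Nat.card_eq_fintype_card, hq]
  simp [Finset.sum_range_succ]

/-- The parity check of the roots of exponents `0, …, q + 1`, without the redundant exponent `q`. -/
noncomputable def lowCheck (q : ℕ) (x : Fin n → K) :
    (Fin n → F) →ₗ[F] F × F × (Fin (q - 1) → K) :=
  (Fintype.linearCombination F (fun _ => (1 : F))).prod
    ((Fintype.linearCombination F (fun i => Algebra.norm F (x i))).prod
      (LinearMap.pi fun l => syndrome x (l + 1)))

/-- The parity check of the roots of exponents `q + 2, …, 2 * q - 1`. -/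
noncomputable def highCheck (q : ℕ) (x : Fin n → K) :
    (Fin n → F) →ₗ[F] Fin (q - 2) → K :=
  LinearMap.pi fun l => syndrome x (q + 2 + l)

/-- Exponent q is the Frobenius conjugate of exponent 1, and exponent q + 1 is the norm, so its
syndrome already lives in F. -/
theorem syndrome_eq_zero_of_lowCheck_eq_zero [Fintype F] [Finite K]
    (hq : Fintype.card F = q) (hq2 : 2 ≤ q)
    (hK : Module.finrank F K = 2) {x : Fin n → K} {v : Fin n → F} (h : lowCheck q x v = 0)
    {j : ℕ} (hj : j < q + 2) : syndrome x j v = 0 := by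
  have h0 : Fintype.linearCombination F (fun _ => (1 : F)) v = 0 := congrArg Prod.fst h
  have h1 : Fintype.linearCombination F (fun i => Algebra.norm F (x i)) v = 0 :=
    congrArg (fun y => y.2.1) h
  have h2' : ∀ l : Fin (q - 1), syndrome x (l + 1) v = 0 :=
    fun l => congrFun (congrArg (fun y => y.2.2) h) l
  rcases Nat.eq_zero_or_pos j with rfl | hj0
  · have := congrArg (algebraMap F K) h0
    simpa [Fintype.linearCombination_apply, syndrome_apply] using this
  rcases lt_trichotomy j q with hjq | rfl | hjq
  · have := h2' ⟨j - 1, by omega⟩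
    rwa [show j - 1 + 1 = j by omega] at this
  · have h3 := h2' ⟨0, by omega⟩
    have h4 := syndrome_mul_card hq x 1 v
    simp only [zero_add] at h3
    rw [h3, one_mul, zero_pow (by omega)] at h4
    exact h4
  · obtain rfl : j = q + 1 := by omega
    have := congrArg (algebraMap F K) h1
    simpa [Fintype.linearCombination_apply, syndrome_apply,
      algebraMap_norm_eq_pow_add_one hq hK] using this

theorem syndrome_eq_zero_of_highCheck_eq_zero {x : Fin n → K} {v : Fin n → F}
    (h : highCheck q x v = 0) {j : ℕ} (hj : j < q - 2) : syndrome x (q + 2 + j) v = 0 :=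
  congrFun h ⟨j, hj⟩

/-- After reduction of exponents modulo n, the expression is a polynomial of degree below n with n
distinct roots, hence zero; each unknown is then isolated as a single coefficient. -/
theorem conjugate_coefficients_eq_zero (hq2 : 3 ≤ q) (hn : n = q ^ 2 - 1) {x : Fin n → K}
    (hx : Function.Injective x) (hxn : ∀ i, x i ^ n = 1) {c₀ c₁ : K} {a : Fin (q - 1) → K}
    {b : Fin (q - 2) → K}
    (h : ∀ i, c₀ + c₁ * x i ^ (q + 1) +
      (∑ l, (a l * x i ^ (l + 1 : ℕ) + (a l * x i ^ (l + 1 : ℕ)) ^ q) +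
        ∑ l, (b l * x i ^ (q + 2 + l : ℕ) + (b l * x i ^ (q + 2 + l : ℕ)) ^ q)) = 0) :
    c₀ = 0 ∧ c₁ = 0 ∧ a = 0 ∧ b = 0 := by
  have hq3 : q * 3 ≤ q ^ 2 := by rw [pow_two]; exact Nat.mul_le_mul_left q hq2
  let P : K[X] := C c₀ + C c₁ * X ^ (q + 1) +
    (∑ l : Fin (q - 1), (C (a l) * X ^ (l + 1 : ℕ) + C (a l ^ q) * X ^ ((l + 1) * q : ℕ)) +
      ∑ l : Fin (q - 2), (C (b l) * X ^ (q + 2 + l : ℕ) + C (b l ^ q) * X ^ ((l + 2) * q + 1 : ℕ)))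
  have hm1 : ∀ l : Fin (q - 1), ((l : ℕ) + 1) * q + q ≤ q ^ 2 := by
    intro l
    have := l.2
    calc ((l : ℕ) + 1) * q + q = (l + 2) * q := by ring
      _ ≤ q * q := Nat.mul_le_mul_right q (by omega)
      _ = q ^ 2 := by ring
  have hm2 : ∀ l : Fin (q - 2), ((l : ℕ) + 2) * q + q ≤ q ^ 2 := by
    intro l
    have := l.2
    calc ((l : ℕ) + 2) * q + q = (l + 3) * q := by ring
      _ ≤ q * q := Nat.mul_le_mul_right q (by omega)
      _ = q ^ 2 := by ring
  have hmon : ∀ (c : K) (m : ℕ), m < n → (C c * X ^ m : K[X]) ∈ degreeLT K n := by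
    intro c m hm
    rw [mem_degreeLT]
    exact (degree_C_mul_X_pow_le m c).trans_lt (by exact_mod_cast hm)
  have hdeg : P ∈ degreeLT K n := by
    refine add_mem (add_mem ?_ (hmon _ _ (by omega))) (add_mem
      (sum_mem fun l _ => add_mem (hmon _ _ ?_) (hmon _ _ ?_))
      (sum_mem fun l _ => add_mem (hmon _ _ ?_) (hmon _ _ ?_)))
    · simpa using hmon c₀ 0 (by omega)
    all_goals first | have := hm1 l | have := hm2 l
    all_goals have := l.2
    all_goals omega
  have heval : ∀ i, P.eval (x i) = 0 := by
    intro i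
    rw [← h i]
    simp only [P, eval_add, eval_C, eval_mul, eval_pow, eval_X, eval_finsetSum]
    congr 2
    · exact Finset.sum_congr rfl fun l _ => by rw [mul_pow, ← pow_mul]
    · refine Finset.sum_congr rfl fun l _ => ?_
      rw [mul_pow, ← pow_mul, show (q + 2 + (l : ℕ)) * q = (l + 2) * q + 1 + n by
        rw [hn]
        have : (q + 2 + (l : ℕ)) * q = (l + 2) * q + q ^ 2 := by ring
        omega, pow_add _ _ n, hxn, mul_one]
  have hP : P = 0 := by
    refine eq_zero_of_degree_lt_of_eval_finset_eq_zero (Finset.univ.map ⟨x, hx⟩) ?_ ?_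
    · simpa using mem_degreeLT.1 hdeg
    · simpa using heval
  have hcoeff : ∀ m, (if m = 0 then c₀ else 0) + (if m = q + 1 then c₁ else 0) +
      (∑ l : Fin (q - 1), ((if m = l + 1 then a l else 0) +
          if m = (l + 1) * q then a l ^ q else 0) +
        ∑ l : Fin (q - 2), ((if m = q + 2 + l then b l else 0) +
          if m = (l + 2) * q + 1 then b l ^ q else 0)) = 0 := by
    intro m
    have := congrArg (fun p => coeff p m) hP
    simpa only [P, coeff_add, coeff_C, coeff_C_mul, coeff_X_pow, finsetSum_coeff, mul_ite, mul_one,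
      mul_zero, coeff_zero] using this
  -- Below 2q the only conjugate exponent is q itself, so every other coefficient there involves
  -- unconjugated terms only.
  have hconj1 : ∀ (m : ℕ), m < 2 * q → m ≠ q → ∀ l : Fin (q - 1), m ≠ (l + 1) * q := by
    intro m hm hmq l
    rcases Nat.eq_zero_or_pos (l : ℕ) with h0 | h0
    · simpa [h0] using hmq
    · have := Nat.mul_le_mul_right q (show 2 ≤ (l : ℕ) + 1 by omega)
      omega
  have hconj2 : ∀ (m : ℕ), m < 2 * q → ∀ l : Fin (q - 2), m ≠ (l + 2) * q + 1 := by
    intro m hm l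
    have := Nat.mul_le_mul_right q (show 2 ≤ (l : ℕ) + 2 by omega)
    omega
  have hcoeff' : ∀ m, m < 2 * q → m ≠ q →
      (if m = 0 then c₀ else 0) + (if m = q + 1 then c₁ else 0) +
        (∑ l : Fin (q - 1), (if m = l + 1 then a l else 0) +
          ∑ l : Fin (q - 2), if m = q + 2 + l then b l else 0) = 0 := by
    intro m hm hmq
    have := hcoeff m
    simpa only [hconj1 m hm hmq, hconj2 m hm, if_false, add_zero] using this
  refine ⟨?_, ?_, funext fun l => ?_, funext fun l => ?_⟩
  · have := hcoeff' 0 (by omega) (by omega)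
    rwa [Finset.sum_eq_zero fun l _ => if_neg (by omega),
      Finset.sum_eq_zero fun l _ => if_neg (by omega), if_pos rfl, if_neg (by omega), add_zero,
      add_zero, add_zero] at this
  · have := hcoeff' (q + 1) (by omega) (by omega)
    rwa [Finset.sum_eq_zero fun l _ => if_neg (by omega),
      Finset.sum_eq_zero fun l _ => if_neg (by omega), if_pos rfl, if_neg (by omega), zero_add,
      add_zero, add_zero] at this
  · have := hcoeff' (l + 1) (by omega) (by omega)
    rwa [Finset.sum_eq_single l (fun l' _ hl' => if_neg fun hc => hl' (Fin.ext (by omega)))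
      (by simp), Finset.sum_eq_zero fun l _ => if_neg (by omega), if_pos rfl, if_neg (by omega),
      if_neg (by omega), zero_add, zero_add, add_zero] at this
  · have := hcoeff' (q + 2 + l) (by omega) (by omega)
    rwa [Finset.sum_eq_zero fun l _ => if_neg (by omega),
      Finset.sum_eq_single l (fun l' _ hl' => if_neg fun hc => hl' (Fin.ext (by omega)))
      (by simp), if_pos rfl, if_neg (by omega), if_neg (by omega), zero_add, zero_add,
      zero_add] at this

/-- By duality it suffices that a functional killing the image is zero. Writing its K-components as
traces and testing on unit vectors gives the relation of `conjugate_coefficients_eq_zero`. -/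
theorem surjective_lowCheck_prod_highCheck [Fintype F] [Finite K]
    (hq : Fintype.card F = q) (hq2 : 3 ≤ q)
    (hK : Module.finrank F K = 2) (hn : n = q ^ 2 - 1) {x : Fin n → K}
    (hx : Function.Injective x) (hxn : ∀ i, x i ^ n = 1) :
    Function.Surjective ((lowCheck q x).prod (highCheck q x) :
      (Fin n → F) →ₗ[F] (F × F × (Fin (q - 1) → K)) × (Fin (q - 2) → K)) := by
  classical
  have : FiniteDimensional F K := Module.finite_of_finrank_pos (by omega)
  rw [← LinearMap.dualMap_injective_iff, injective_iff_map_eq_zero]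
  intro φ hφ
  let φ₀ : F →ₗ[F] F := φ ∘ₗ LinearMap.inl F _ _ ∘ₗ LinearMap.inl F _ _
  let φ₁ : F →ₗ[F] F := φ ∘ₗ LinearMap.inl F _ _ ∘ₗ LinearMap.inr F _ _ ∘ₗ LinearMap.inl F _ _
  let φa : Fin (q - 1) → K →ₗ[F] F := fun l =>
    φ ∘ₗ LinearMap.inl F _ _ ∘ₗ LinearMap.inr F _ _ ∘ₗ LinearMap.inr F _ _ ∘ₗ
      LinearMap.single F (fun _ => K) l
  let φb : Fin (q - 2) → K →ₗ[F] F := fun l =>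
    φ ∘ₗ LinearMap.inr F _ _ ∘ₗ LinearMap.single F (fun _ => K) l
  have hdec : ∀ y, φ y = y.1.1 * φ₀ 1 + y.1.2.1 * φ₁ 1 +
      (∑ l, φa l (y.1.2.2 l) + ∑ l, φb l (y.2 l)) := by
    rintro ⟨⟨y₀, y₁, ya⟩, yb⟩
    have h1 : ((y₀, y₁, ya), yb) = y₀ • (((1, 0, 0), 0) : (F × F × (Fin (q - 1) → K)) × _) +
        y₁ • ((0, 1, 0), 0) + (∑ l, ((0, 0, Pi.single l (ya l)), 0) +
          ∑ l, ((0, 0, 0), Pi.single l (yb l))) := by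
      simp [Prod.ext_iff, Prod.fst_sum, Prod.snd_sum, Finset.univ_sum_single]
    rw [h1]
    simp only [map_add, map_smul, map_sum, smul_eq_mul]
    rw [← h1]
    rfl
  choose a ha using fun l => exists_trace_eq (φa l)
  choose b hb using fun l => exists_trace_eq (φb l)
  have key : ∀ i, φ₀ 1 + Algebra.norm F (x i) * φ₁ 1 +
      (∑ l, Algebra.trace F K (a l * x i ^ (l + 1 : ℕ)) +
        ∑ l, Algebra.trace F K (b l * x i ^ (q + 2 + l : ℕ))) = 0 := by
    intro i
    have h1 := LinearMap.congr_fun hφ (Pi.single i 1)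
    have h2 : ∀ j, syndrome x j (Pi.single i (1 : F)) = x i ^ j := by
      intro j
      rw [syndrome_apply, Finset.sum_eq_single i]
      · simp
      · intro i' _ hi'
        simp [hi']
      · simp
    rw [LinearMap.dualMap_apply, hdec] at h1
    simpa [lowCheck, highCheck, h2, ha, hb, Fintype.linearCombination_apply, Pi.single_apply]
      using h1
  obtain ⟨h0, h1, hA, hB⟩ := conjugate_coefficients_eq_zero (c₀ := algebraMap F K (φ₀ 1))
    (c₁ := algebraMap F K (φ₁ 1)) (a := a) (b := b) hq2 hn hx hxn fun i => by
      have := congrArg (algebraMap F K) (key i)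
      simp only [map_add, map_mul, map_sum, map_zero, algebraMap_norm_eq_pow_add_one hq hK,
        algebraMap_trace_eq_add_pow hq hK] at this
      rw [← this]
      ring
  rw [map_eq_zero] at h0 h1
  refine LinearMap.ext fun y => ?_
  rw [hdec]
  simp [h0, h1, ha, hb, hA, hB]

theorem exists_units_enumeration [Finite K] (hn : n = Nat.card K - 1) :
    ∃ x : Fin n → K, Function.Injective x ∧ (∀ i, x i ≠ 0) ∧ ∀ i, x i ^ n = 1 := by
  classical
  have := Fintype.ofFinite K
  rw [Nat.card_eq_fintype_card, ← Fintype.card_units] at hn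
  let e : Fin n ≃ Kˣ := (Fintype.equivFinOfCardEq hn.symm).symm
  refine ⟨fun i => e i, Units.val_injective.comp e.injective, fun i => (e i).ne_zero, fun i => ?_⟩
  have h : e i ^ n = 1 := (congrArg (e i ^ ·) hn).trans pow_card_eq_one
  simpa using congrArg Units.val h

end BCHCode

/-! ### The code over F from the quadratic extension. -/

theorem mainTheorem6 (q n : ℕ) (hq : IsPrimePow q) (hq4 : 4 ≤ q) (hn : n = q ^ 2 - 1)
    (F : Type*) [Field F] [Fintype F] (hF : Fintype.card F = q) :
    ∃ (C : Submodule (Polynomial F) (Fin n → Polynomial F)) (d : ℕ),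
      2 * q + 1 ≤ d ∧
      ConvCode.IsConvolutionalCode C (n - 2 * q) (2 * q - 4) 1 d := by
  classical
  obtain ⟨p, _⟩ := CharP.exists F
  have : Fact p.Prime := ⟨CharP.char_is_prime F p⟩
  let K := FiniteField.Extension F p 2
  have hK : Module.finrank F K = 2 := FiniteField.finrank_extension F p 2
  have hcard : Nat.card K = q ^ 2 := by
    rw [FiniteField.natCard_extension, Nat.card_eq_fintype_card, hF]
  obtain ⟨x, hx, hx0, hxn⟩ := BCHCode.exists_units_enumeration (K := K) (hcard ▸ hn)
  let ι : (Fin (q - 2) → K) →ₗ[F] F × F × (Fin (q - 1) → K) :=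
    LinearMap.inr F _ _ ∘ₗ LinearMap.inr F _ _ ∘ₗ
      LinearMap.pi fun l => if h : (l : ℕ) < q - 2 then LinearMap.proj ⟨l, h⟩ else 0
  have hι : Function.Injective ι := by
    rw [injective_iff_map_eq_zero]
    intro y hy
    funext l
    have := congrFun (congrArg (fun z => z.2.2) hy) ⟨l, by omega⟩
    simpa [ι] using this
  have hlow : ∀ w : Fin n → F, BCHCode.lowCheck q x w = 0 → ∀ j < q + 2,
      BCHCode.syndrome x j w = 0 := fun w hw j hj =>
    BCHCode.syndrome_eq_zero_of_lowCheck_eq_zero hF (by omega) hK hw hj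
  have hhigh : ∀ w : Fin n → F, BCHCode.highCheck q x w = 0 → ∀ j < q - 2,
      BCHCode.syndrome x (q + 2 + j) w = 0 := fun w hw j hj =>
    BCHCode.syndrome_eq_zero_of_highCheck_eq_zero hw hj
  -- The BCH bound for H₀ is q + 3; `d₀` is lowered to q + 2 so that `d₀ + d₁` equals 2q + 1, the
  -- bound for the joint kernel.
  obtain ⟨C, d, hd, hC⟩ := ConvCode.exists_isConvolutionalCode_of_surjective
    (BCHCode.surjective_lowCheck_prod_highCheck hF (by omega) hK hn hx hxn) hι (m₀ := 2 * q)
    (m₁ := 2 * q - 4) (d₀ := q + 2) (d₁ := q - 1)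
    (by simp [Module.finrank_prod, Module.finrank_pi_fintype, hK]; omega)
    (by simp [Module.finrank_pi_fintype, hK]; omega) (by omega)
    (fun w hw h => (BCHCode.lt_hammingNorm_of_syndrome_eq_zero hx hx0 (b := 0) hw
      fun j hj => by simpa using hlow w h j hj).le)
    (fun w hw h => by
      have := BCHCode.lt_hammingNorm_of_syndrome_eq_zero hx hx0 hw (hhigh w h)
      omega)
    (fun w hw h h' => by
      have := BCHCode.lt_hammingNorm_of_syndrome_eq_zero hx hx0 (b := 0) (d := 2 * q) hw
        fun j hj => by
          rw [zero_add]
          by_cases hjq : j < q + 2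
          · exact hlow w h j hjq
          · have := hhigh w h' (j - (q + 2)) (by omega)
            rwa [show q + 2 + (j - (q + 2)) = j by omega] at this
      omega)
  exact ⟨C, d, by omega, hC⟩
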